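/- Let $G$ be a finite abelian group (written additively) of order $n$, let $1\le k<n$, and let $A\subset G$. The sum complex $X_{A,k}$ is the simplicial complex on the vertex set $G$ consisting of all non-empty subsets of $G$ with at most $k$ elements together with all $(k+1)$-element subsets $\sigma\subset G$ such that $\sum_{x\in\sigma}x\in A$. For a finite simplicial complex $X$ and $j\ge 0$, let $C^j(X)$ be the space of complex valued skew-symmetric functions on the ordered $j$-simplices of $X$, let $C^{-1}(X)=\mathbb C$, and let $d_j:C^j(X)\to C^{j+1}(X)$ be the coboundary operator $d_j\phi([v_0,\dots,v_{j+1}])=\sum_{i=0}^{j+1}(-1)^i\phi([v_0,\dots,\widehat{v_i},\dots,v_{j+1}])$, with $d_{-1}(a)(v)=a$. Equip $C^j(X)$ with the inner product $(\phi,\psi)_X=\sum_{\sigma}\phi(\sigma)\overline{\psi(\sigma)}$, the sum being over the $j$-simplices of $X$, each taken with an arbitrary fixed orientation (for $j=-1$, the standard inner product on $\mathbb C$), and let $d_j^*$ be the adjoint of $d_j$. The $j$-th spectral gap $\mu_j(X)$ is the minimal eigenvalue of the reduced Laplacian $L_j(X)=d_{j-1}d_{j-1}^*+d_j^*d_j$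 on $C^j(X)$, $j\ge 0$. **Theorem 1.2.** Let $k\ge 1$ be an integer and let $\epsilon>0$. Let $G$ be an abelian group of finite order $n$ with $n>k$ and $n>\frac{2^{10}k^8}{\epsilon^8}$, and let $m=\left\lceil\frac{4k^2\log n}{\epsilon^2}\right\rceil$, where $\log$ is the natural logarithm. Then $m\le n$, and if $A$ is chosen uniformly at random among the $m$-element subsets of $G$, then $$\Pr\big[\,\mu_{k-1}(X_{A,k})<(1-\epsilon)m\,\big]<\frac{6}{n}.$$ -/

import Mathlib

namespace SumComplexGap

/-! ### Ordered simplices and cochains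

Throughout, `X` is a simplicial complex whose vertices lie in `V`, and objects of dimension `d` are
indexed by their number of vertices `p = d + 1`; thus `p = 0` is the augmentation degree `-1`,
whose only simplex is the empty one. -/

section Cochains

variable {V : Type*}

/-- The set `X(p-1)` of unoriented simplices with `p` vertices (the empty simplex if `p = 0`). -/
def Simplex (X : PreAbstractSimplicialComplex V) (p : ℕ) : Type _ :=
  {s : Finset V // s.card = p ∧ (s.Nonempty → s ∈ X.faces)}

/-- Ordered simplices `[v₀, …, v_{p-1}]` of `X`: lists of `p` distinct vertices spanning a simplex
of `X` (for `p = 0` the empty list). -/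
def OrderedSimplex (X : PreAbstractSimplicialComplex V) (p : ℕ) : Type _ :=
  {v : Fin p ↪ V // (Finset.univ.map v).Nonempty → Finset.univ.map v ∈ X.faces}

variable {X : PreAbstractSimplicialComplex V} {p : ℕ}

/-- The reordering `[v_{π 0}, …, v_{π (p-1)}]` of an ordered simplex. -/
def OrderedSimplex.reorder (σ : OrderedSimplex X p) (π : Equiv.Perm (Fin p)) :
    OrderedSimplex X p :=
  ⟨π.toEmbedding.trans σ.1, by
    have h : Finset.univ.map (π.toEmbedding.trans σ.1) = Finset.univ.map σ.1 := by
      rw [← Finset.map_map, Finset.map_univ_equiv]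
    rw [h]; exact σ.2⟩

/-- The `i`-face `[v₀, …, v̂ᵢ, …, v_p]` of an ordered simplex `[v₀, …, v_p]`. -/
def OrderedSimplex.face (σ : OrderedSimplex X (p + 1)) (i : Fin (p + 1)) : OrderedSimplex X p :=
  ⟨(Fin.succAboveEmb i).trans σ.1, fun hne => by
    have hsub : Finset.univ.map ((Fin.succAboveEmb i).trans σ.1) ⊆ Finset.univ.map σ.1 := by
      rw [← Finset.map_map]; exact Finset.map_subset_map.2 (Finset.subset_univ _)
    exact (X.isRelLowerSet_faces (σ.2 (hne.mono hsub))).2 hsub hne⟩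

/-- A fixed, arbitrarily chosen orientation (an ordering of the vertices) of every simplex. -/
noncomputable def Simplex.orient (s : Simplex X p) : OrderedSimplex X p :=
  ⟨(s.1.equivFinOfCardEq s.2.1).symm.toEmbedding.trans (Function.Embedding.subtype _), by
    have h : Finset.univ.map ((s.1.equivFinOfCardEq s.2.1).symm.toEmbedding.trans
        (Function.Embedding.subtype _)) = s.1 := by
      rw [← Finset.map_map, Finset.map_univ_equiv]
      ext x; simp
    rw [h]; exact s.2.2⟩

variable (X p) in
/-- The skew-symmetric functions on the ordered simplices with `p` vertices. -/
def skewSymmetric : Submodule ℂ (OrderedSimplex X p → ℂ) where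
  carrier := {φ | ∀ (σ : OrderedSimplex X p) (π : Equiv.Perm (Fin p)),
    φ (σ.reorder π) = ((Equiv.Perm.sign π : ℤ) : ℂ) * φ σ}
  add_mem' := fun {a b} ha hb σ π => by simp [ha σ π, hb σ π, mul_add]
  zero_mem' := fun σ π => by simp
  smul_mem' := fun c a ha σ π => by simp [ha σ π]; ring

variable (X p) in
/-- The space `C^{p-1}(X)` of complex valued simplicial cochains. -/
def Cochain : Type _ := skewSymmetric X p

noncomputable instance : AddCommGroup (Cochain X p) :=
  inferInstanceAs (AddCommGroup (skewSymmetric X p))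

noncomputable instance : Module ℂ (Cochain X p) :=
  inferInstanceAs (Module ℂ (skewSymmetric X p))

instance : CoeFun (Cochain X p) (fun _ => OrderedSimplex X p → ℂ) := ⟨fun φ => φ.1⟩

theorem exists_face_perm (π : Equiv.Perm (Fin (p + 1))) (i : Fin (p + 1)) :
    ∃ e : Equiv.Perm (Fin p), (∀ j, π (i.succAbove j) = (π i).succAbove (e j)) ∧
      Equiv.Perm.sign e = Equiv.Perm.sign π * (-1) ^ ((i : ℕ) + (π i : ℕ)) := by
  set ρ : Equiv.Perm (Fin (p + 1)) := (π i).cycleRange * π * i.cycleRange⁻¹ with hρ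
  have h0 : ρ 0 = 0 := by
    simp [hρ, Equiv.Perm.mul_apply, Equiv.Perm.inv_def]
  obtain ⟨⟨a, e⟩, he⟩ := Equiv.Perm.decomposeFin.symm.surjective ρ
  have ha : a = 0 := by
    have := Equiv.Perm.decomposeFin_symm_apply_zero a e
    rw [he, h0] at this; exact this.symm
  subst ha
  refine ⟨e, fun j => ?_, ?_⟩
  · have h1 : ρ j.succ = (e j).succ := by
      rw [← he, Equiv.Perm.decomposeFin_symm_apply_succ]; simp
    rw [← Fin.cycleRange_symm_succ, ← Fin.cycleRange_symm_succ, ← h1]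
    simp [hρ, Equiv.Perm.mul_apply, Equiv.Perm.inv_def]
  · have h2 : Equiv.Perm.sign ρ = Equiv.Perm.sign e := by
      rw [← he, Equiv.Perm.decomposeFin.symm_sign]; simp
    rw [← h2, hρ]
    simp only [map_mul, Fin.sign_cycleRange, Equiv.Perm.sign_inv]
    rw [pow_add]; ac_rfl

variable (X p) in
/-- The coboundary operator `d : C^{p-1}(X) → C^p(X)`,
`(d φ)(σ) = ∑ i, (-1)^i φ(σ_i)`; for `p = 0` it is the augmentation `(d a)(v) = a`. -/
noncomputable def coboundary : Cochain X p →ₗ[ℂ] Cochain X (p + 1) where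
  toFun φ := ⟨fun σ => ∑ i : Fin (p + 1), (-1 : ℂ) ^ (i : ℕ) * φ (σ.face i), fun σ π => by
    rw [Finset.mul_sum, ← Equiv.sum_comp π (fun i => _ * ((-1 : ℂ) ^ (i : ℕ) * φ (σ.face i)))]
    refine Finset.sum_congr rfl fun i _ => ?_
    obtain ⟨e, he, hs⟩ := exists_face_perm π i
    have hf : (σ.reorder π).face i = (σ.face (π i)).reorder e := by
      apply Subtype.ext
      ext j
      exact congrArg σ.1 (he j)
    rw [hf, φ.2 _ e, hs]
    push_cast
    rw [pow_add]
    have hi : ((-1 : ℂ) ^ (i : ℕ)) * (-1) ^ (i : ℕ) = 1 := by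
      rw [← mul_pow]; simp
    linear_combination (((Equiv.Perm.sign π : ℤ) : ℂ) * (-1) ^ (π i : ℕ) * φ (σ.face (π i))) * hi⟩
  map_add' φ ψ := by
    apply Subtype.ext; funext σ
    change ∑ i, _ * (φ (σ.face i) + ψ (σ.face i)) = ∑ i, _ + ∑ i, _
    rw [← Finset.sum_add_distrib]; exact Finset.sum_congr rfl fun i _ => mul_add _ _ _
  map_smul' c φ := by
    apply Subtype.ext; funext σ
    change ∑ i, _ * (c * φ (σ.face i)) = c * ∑ i, _
    rw [Finset.mul_sum]; exact Finset.sum_congr rfl fun i _ => mul_left_comm _ _ _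

theorem exists_orient (σ : OrderedSimplex X p) :
    ∃ (s : Simplex X p) (π : Equiv.Perm (Fin p)), σ = s.orient.reorder π := by
  have hc : (Finset.univ.map σ.1).card = p := by simp
  let s : Simplex X p := ⟨Finset.univ.map σ.1, hc, σ.2⟩
  let f : Fin p → s.1 := fun i => ⟨σ.1 i, by simp [s]⟩
  have hf : Function.Bijective f := by
    refine ⟨fun i j h => σ.1.injective (congrArg Subtype.val h), fun ⟨x, hx⟩ => ?_⟩
    obtain ⟨i, -, hi⟩ := Finset.mem_map.1 hx
    exact ⟨i, Subtype.ext hi⟩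
  refine ⟨s, (Equiv.ofBijective f hf).trans (s.1.equivFinOfCardEq hc), ?_⟩
  apply Subtype.ext
  ext i
  simp [OrderedSimplex.reorder, Simplex.orient, f]

/-! ### The standard inner product on cochains -/

variable [Finite V]

instance : Finite (Simplex X p) := Subtype.finite

instance : Finite (OrderedSimplex X p) := Subtype.finite

noncomputable instance : Fintype (Simplex X p) := Fintype.ofFinite _

/-- The standard inner product `(φ, ψ) = ∑_{σ ∈ X(p-1)} φ(σ) conj (ψ(σ))`, every simplex being
taken with its fixed orientation. (In Mathlib's convention the conjugate falls on the first
argument of `inner`.) -/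
noncomputable abbrev cochainCore : InnerProductSpace.Core ℂ (Cochain X p) where
  inner φ ψ := ∑ s : Simplex X p, (starRingEnd ℂ) (φ s.orient) * ψ s.orient
  conj_inner_symm φ ψ := by
    simp only [map_sum, map_mul, Complex.conj_conj]
    exact Finset.sum_congr rfl fun s _ => mul_comm _ _
  re_inner_nonneg φ := by
    rw [map_sum]
    refine Finset.sum_nonneg fun s _ => ?_
    rw [mul_comm, Complex.mul_conj]
    exact Complex.normSq_nonneg _
  add_left φ ψ χ := by
    rw [← Finset.sum_add_distrib]
    refine Finset.sum_congr rfl fun s _ => ?_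
    change (starRingEnd ℂ) (φ s.orient + ψ s.orient) * _ = _
    rw [map_add, add_mul]
  smul_left φ ψ c := by
    rw [Finset.mul_sum]
    refine Finset.sum_congr rfl fun s _ => ?_
    change (starRingEnd ℂ) (c * φ s.orient) * _ = _
    rw [map_mul, mul_assoc]
  definite φ h := by
    have h' : ∑ s : Simplex X p, Complex.normSq (φ s.orient) = 0 := by
      have := congrArg Complex.re h
      rw [Complex.re_sum] at this
      simpa [mul_comm, Complex.mul_conj] using this
    rw [Finset.sum_eq_zero_iff_of_nonneg fun s _ => Complex.normSq_nonneg _] at h'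
    apply Subtype.ext; funext σ
    obtain ⟨s, π, rfl⟩ := exists_orient σ
    rw [φ.2 s.orient π, Complex.normSq_eq_zero.1 (h' s (Finset.mem_univ _)), mul_zero]
    rfl

noncomputable instance : NormedAddCommGroup (Cochain X p) :=
  (cochainCore : InnerProductSpace.Core ℂ (Cochain X p)).toNormedAddCommGroup

noncomputable instance : InnerProductSpace ℂ (Cochain X p) :=
  InnerProductSpace.ofCore (cochainCore : InnerProductSpace.Core ℂ (Cochain X p)).toCore

instance : FiniteDimensional ℂ (Cochain X p) :=
  inferInstanceAs (FiniteDimensional ℂ (skewSymmetric X p))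

/-! ### Laplacians and spectral gaps -/

variable (X) in
/-- The reduced `k`-th Laplacian `L_k(X) = d_{k-1} d_{k-1}^* + d_k^* d_k` on
`C^k(X) = Cochain X (k + 1)`, for `k ≥ 0`. -/
noncomputable def laplacian (k : ℕ) : Cochain X (k + 1) →ₗ[ℂ] Cochain X (k + 1) :=
  coboundary X k ∘ₗ LinearMap.adjoint (coboundary X k) +
    LinearMap.adjoint (coboundary X (k + 1)) ∘ₗ coboundary X (k + 1)

variable (X) in
/-- The `k`-th spectral gap `μ_k(X)`: the minimal eigenvalue of `L_k(X)`. (`L_k(X)` is Hermitian,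
so all its eigenvalues are real; they form a finite set, nonempty as soon as `X` has a
`k`-simplex, and the infimum is then a minimum.) -/
noncomputable def spectralGap (k : ℕ) : ℝ :=
  sInf {r : ℝ | Module.End.HasEigenvalue (laplacian X k) (r : ℂ)}

end Cochains

/-! ### Sum complexes and random subsets -/

/-- The sum complex `X_{A,k}`: the full `(k-1)`-skeleton of the simplex on the vertex set `G`,
together with all `(k+1)`-subsets of `G` whose sum lies in `A`. -/
def sumComplex {G : Type*} [AddCommGroup G] (A : Finset G) (k : ℕ) :
    PreAbstractSimplicialComplex G where
  faces := {s | s.Nonempty ∧ (s.card ≤ k ∨ (s.card = k + 1 ∧ ∑ x ∈ s, x ∈ A))}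
  isRelLowerSet_faces := by
    rintro s ⟨hs, h⟩
    refine ⟨hs, fun t hts ht => ⟨ht, ?_⟩⟩
    have hts' : t ⊆ s := hts
    rcases h with h | ⟨h, hA⟩
    · exact Or.inl ((Finset.card_le_card hts').trans h)
    · rcases eq_or_ne t s with rfl | hne
      · exact Or.inr ⟨h, hA⟩
      · have := Finset.card_lt_card (Finset.ssubset_iff_subset_ne.2 ⟨hts', hne⟩)
        exact Or.inl (by omega)

open Classical in
/-- The probability that a uniformly random `m`-element subset `A` of the finite set `G`
satisfies `P`. -/
noncomputable def probSubset (G : Type*) [Fintype G] (m : ℕ) (P : Finset G → Prop) : ℝ :=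
  (((Finset.univ : Finset G).powersetCard m).filter P).card /
    ((Finset.univ : Finset G).powersetCard m).card

end SumComplexGap

/-! Write `k = j + 1`. The gap is controlled by the nontrivial Fourier coefficients of the indicator
of `A`; these are small for random `A`.

Deterministic part. Extend a cochain φ by zero to a skew-symmetric function on all tuples. Since the
`j`-skeleton is full, `d*φ` is the contraction `z ↦ ∑ u, φ(u, z)`, and `dφ` is the coboundary on
tuples cut off by the condition that the coordinate sum lies in `A`. Expanding `‖dφ‖²` gives `|A|
‖φ‖²` minus, for each `z`, a form in `v ↦ φ(v, z)` with kernel `1_A(u + v + s)`, where `s = ∑ z i`.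
Diagonalise this form by characters (`sum_sum_indicator_le`). The trivial character costs at most
`|∑ v, φ(v, z)|²`, and summed over `z` this is exactly compensated by `‖d*φ‖²`; the others cost at
most `c`, a bound on their sums over `A`. Hence the gap is at least `|A| - k c`
(`card_sub_le_spectralGap`).

Random part. A small gap forces a nontrivial character sum of size at least `t = εm/k`. For `m`
independent uniform draws, Hoeffding's inequality (`card_norm_sum_ge_le`) bounds each such event by
`2 exp(-t²/(2m)) ≤ 2/n²`, and there are `n - 1` nontrivial characters. Since `m` is of order at most
`√n`, the draws are distinct with probability at least `1/3`, so passing to subsets costs a factor 3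
and yields `6/n`. -/

namespace SumComplexGap

open ComplexConjugate

/-! ### Skew-symmetric functions on tuples and their coboundary -/

section Tuples

variable {V : Type*} {p : ℕ}

/-- Functions on `p`-tuples that change by the sign under permutations of the coordinates. -/
def IsSkew (f : (Fin p → V) → ℂ) : Prop :=
  ∀ (x : Fin p → V) (π : Equiv.Perm (Fin p)), f (x ∘ π) = ((Equiv.Perm.sign π : ℤ) : ℂ) * f x

/-- The coboundary of a function on tuples. -/
noncomputable def tupleCoboundary (f : (Fin p → V) → ℂ) (x : Fin (p + 1) → V) : ℂ :=
  ∑ i : Fin (p + 1), (-1 : ℂ) ^ (i : ℕ) * f (x ∘ i.succAbove)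

theorem IsSkew.apply_cons {f : (Fin (p + 1) → V) → ℂ} (hf : IsSkew f) (u : V) :
    IsSkew fun y => f (Fin.cons u y) := by
  intro y π
  have h1 : (Fin.cons u (y ∘ π) : Fin (p + 1) → V) =
      Fin.cons u y ∘ Equiv.Perm.decomposeFin.symm (0, π) := by
    funext i
    refine Fin.cases ?_ (fun i => ?_) i <;> simp
  simp only [h1, hf _ (Equiv.Perm.decomposeFin.symm (0, π)), Equiv.Perm.decomposeFin.symm_sign]
  simp

theorem IsSkew.coboundary {f : (Fin p → V) → ℂ} (hf : IsSkew f) :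
    IsSkew (tupleCoboundary f) := by
  intro x π
  unfold tupleCoboundary
  rw [Finset.mul_sum,
    ← Equiv.sum_comp π (fun i => _ * ((-1 : ℂ) ^ (i : ℕ) * f (x ∘ i.succAbove)))]
  refine Finset.sum_congr rfl fun i _ => ?_
  obtain ⟨e, he, hs⟩ := exists_face_perm π i
  have h1 : (x ∘ π) ∘ i.succAbove = (x ∘ (π i).succAbove) ∘ e := by
    funext j
    exact congrArg x (he j)
  rw [h1, hf _ e, hs]
  push_cast
  rw [pow_add]
  have hi : ((-1 : ℂ) ^ (i : ℕ)) * (-1) ^ (i : ℕ) = 1 := by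
    rw [← mul_pow]; simp
  linear_combination
    (((Equiv.Perm.sign π : ℤ) : ℂ) * (-1) ^ (π i : ℕ) * f (x ∘ (π i).succAbove)) * hi

theorem IsSkew.eq_zero_of_not_injective {f : (Fin p → V) → ℂ} (hf : IsSkew f) {x : Fin p → V}
    (hx : ¬ Function.Injective x) : f x = 0 := by
  simp only [Function.Injective, not_forall] at hx
  obtain ⟨a, b, hab, hne⟩ := hx
  have h1 : x ∘ Equiv.swap a b = x := by
    funext i
    simp only [Function.comp_apply, Equiv.swap_apply_def]
    split_ifs with h h <;> simp_all
  have h2 := hf x (Equiv.swap a b)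
  rw [h1, Equiv.Perm.sign_swap hne] at h2
  push_cast at h2
  have h3 : 2 * f x = 0 := by linear_combination h2
  simpa using h3

/-- Separating the face that omits `u` is what later splits the energy into a diagonal and a cross
term. -/
theorem tupleCoboundary_cons (f : (Fin (p + 1) → V) → ℂ) (u : V) (y : Fin (p + 1) → V) :
    tupleCoboundary f (Fin.cons u y) =
      f y - tupleCoboundary (fun z => f (Fin.cons u z)) y := by
  unfold tupleCoboundary
  rw [Fin.sum_univ_succ, sub_eq_add_neg, ← Finset.sum_neg_distrib]
  congr 1
  · have : (Fin.cons u y : Fin (p + 1 + 1) → V) ∘ Fin.succAbove 0 = y := by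
      funext i; simp
    rw [this]; simp
  · refine Finset.sum_congr rfl fun i _ => ?_
    have : (Fin.cons u y : Fin (p + 1 + 1) → V) ∘ i.succ.succAbove =
        Fin.cons u (y ∘ i.succAbove) := by
      funext j
      refine Fin.cases ?_ (fun j => ?_) j <;> simp
    rw [this, Fin.val_succ, pow_succ]
    ring

variable [Fintype V]

theorem sum_tuple_succ {M : Type*} [AddCommMonoid M] (F : (Fin (p + 1) → V) → M) :
    ∑ x, F x = ∑ u : V, ∑ y : Fin p → V, F (Fin.cons u y) := by
  rw [← Fintype.sum_prod_type']
  exact ((Fin.consEquiv fun _ : Fin (p + 1) => V).sum_comp F).symm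

/-- All `p + 1` faces contribute equally: a cycle moves the omitted coordinate to the front, and its
sign under `g` cancels the sign of the face. -/
theorem IsSkew.sum_mul_conj_tupleCoboundary {g : (Fin (p + 1) → V) → ℂ} (hg : IsSkew g)
    (h : (Fin p → V) → ℂ) :
    ∑ x, g x * conj (tupleCoboundary h x) =
      (p + 1) * ∑ u : V, ∑ y : Fin p → V, g (Fin.cons u y) * conj (h y) := by
  simp only [tupleCoboundary, map_sum, Finset.mul_sum]
  rw [Finset.sum_comm]
  have key : ∀ i : Fin (p + 1),
      ∑ x, g x * conj ((-1 : ℂ) ^ (i : ℕ) * h (x ∘ i.succAbove)) =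
        ∑ u : V, ∑ y : Fin p → V, g (Fin.cons u y) * conj (h y) := by
    intro i
    have h0 : ∑ u : V, ∑ y : Fin p → V, g (Fin.cons u y) * conj (h y) =
        ∑ x : Fin (p + 1) → V, g x * conj (h (x ∘ Fin.succ)) := by
      rw [sum_tuple_succ]
      exact Finset.sum_congr rfl fun u _ => Finset.sum_congr rfl fun y _ => by
        congr 3
    rw [h0, ← (Equiv.arrowCongr i.cycleRange (Equiv.refl V)).sum_comp
      fun x => g x * conj (h (x ∘ Fin.succ))]
    refine Finset.sum_congr rfl fun x _ => ?_
    have h1 : (Equiv.arrowCongr i.cycleRange (Equiv.refl V)) x = x ∘ i.cycleRange.symm := rfl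
    have h2 : (x ∘ i.cycleRange.symm) ∘ Fin.succ = x ∘ i.succAbove := by
      funext j; simp
    simp only [h1, h2]
    rw [hg x i.cycleRange.symm, Equiv.Perm.sign_symm, Fin.sign_cycleRange]
    simp
    ring
  rw [Finset.sum_congr rfl fun i _ => key i]
  simp [Finset.mul_sum]

end Tuples

/-! ### Fourier analysis on `G` -/

section Fourier

variable {G : Type*} [AddCommGroup G] [Fintype G]

theorem sum_norm_sq_characterSum (f : G → ℂ) :
    ∑ χ : AddChar G ℂ, ‖∑ v, χ v * f v‖ ^ 2 = Fintype.card G * ∑ v, ‖f v‖ ^ 2 := by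
  classical
  have h : ∑ χ : AddChar G ℂ, (∑ v, χ v * f v) * conj (∑ v, χ v * f v) =
      Fintype.card G * ∑ v, f v * conj (f v) := by
    have h1 : ∀ χ : AddChar G ℂ, (∑ v, χ v * f v) * conj (∑ v, χ v * f v) =
        ∑ u, ∑ v, χ (u - v) * (f u * conj (f v)) := fun χ => by
      rw [map_sum, Finset.sum_mul_sum]
      refine Finset.sum_congr rfl fun u _ => Finset.sum_congr rfl fun v _ => ?_
      rw [sub_eq_add_neg, AddChar.map_add_eq_mul, AddChar.map_neg_eq_conj, map_mul]
      ring
    simp_rw [h1]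
    rw [Finset.sum_comm, Finset.mul_sum]
    refine Finset.sum_congr rfl fun u _ => ?_
    rw [Finset.sum_comm]
    simp_rw [← Finset.sum_mul, AddChar.sum_apply_eq_ite, sub_eq_zero]
    simp
  simp_rw [Complex.mul_conj'] at h
  exact_mod_cast h

/-- Fourier inversion of the indicator turns the form into a sum over characters; the nontrivial
ones are handled by AM-GM and Parseval. -/
theorem sum_sum_indicator_le (A : Finset G) {c : ℝ} (hc0 : 0 ≤ c)
    (hc : ∀ χ : AddChar G ℂ, χ ≠ 0 → ‖∑ a ∈ A, χ a‖ ≤ c) (s : G) (f : G → ℂ) :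
    ((∑ u, ∑ v, Set.indicator (A : Set G) 1 (u + (v + s)) * (f v * conj (f u))) : ℂ).re ≤
      ‖∑ v, f v‖ ^ 2 + c * ∑ v, ‖f v‖ ^ 2 := by
  classical
  set N : ℝ := (Fintype.card G : ℝ) with hN
  have hNpos : 0 < N := by
    have := Fintype.card_pos (α := G)
    rw [hN]; exact_mod_cast this
  let F : AddChar G ℂ → ℂ := fun χ => ∑ v, χ v * f v
  let C : AddChar G ℂ → ℂ := fun χ => ∑ a ∈ A, χ (-a)
  have hFneg : ∀ χ, ∑ u, χ u * conj (f u) = conj (F (-χ)) := fun χ => by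
    simp only [F, map_sum, map_mul, AddChar.neg_apply, AddChar.map_neg_eq_conj, Complex.conj_conj]
  have hind : ∀ g : G, N * Set.indicator (A : Set G) (1 : G → ℂ) g = ∑ χ, C χ * χ g := fun g => by
    simp only [C, Finset.sum_mul, ← AddChar.map_add_eq_mul]
    rw [Finset.sum_comm]
    simp_rw [AddChar.sum_apply_eq_ite, neg_add_eq_zero]
    simp [Set.indicator_apply, hN]
  -- The kernel depends on `u + v`, not `u - v`, so `F χ` is paired with `F (-χ)`.
  have hsum : N * (∑ u, ∑ v, Set.indicator (A : Set G) 1 (u + (v + s)) * (f v * conj (f u))) =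
      ∑ χ, C χ * χ s * F χ * conj (F (-χ)) := by
    simp_rw [← hFneg, F, mul_assoc, Finset.sum_mul_sum, Finset.mul_sum]
    rw [Finset.sum_comm' (t' := Finset.univ) (s' := fun _ => Finset.univ) (by simp)]
    simp_rw [← mul_assoc, hind, Finset.sum_mul]
    rw [Finset.sum_congr rfl fun u _ => Finset.sum_comm, Finset.sum_comm]
    refine Finset.sum_congr rfl fun χ _ => Finset.sum_congr rfl fun v _ =>
      Finset.sum_congr rfl fun u _ => ?_
    simp only [AddChar.map_add_eq_mul]
    ring
  have hCle : ∀ χ ≠ 0, ‖C χ‖ ≤ c := fun χ hχ => by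
    have := hc (-χ) (by simpa using hχ)
    simpa [C, AddChar.neg_apply] using this
  have hterm : ∀ χ, (C χ * χ s * F χ * conj (F (-χ))).re ≤
      (if χ = 0 then N * ‖∑ v, f v‖ ^ 2 else 0) + c * ((‖F χ‖ ^ 2 + ‖F (-χ)‖ ^ 2) / 2) := by
    intro χ
    split_ifs with h
    · subst h
      have h1 : C 0 * (0 : AddChar G ℂ) s * F 0 * conj (F (-0)) =
          ((A.card * ‖∑ v, f v‖ ^ 2 : ℝ) : ℂ) := by
        rw [Complex.ofReal_mul, Complex.ofReal_pow, ← Complex.mul_conj']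
        simp [C, F, mul_assoc]
      rw [h1, Complex.ofReal_re]
      -- The trivial coefficient is `|A|`; bounding it by `N` suffices, since the `d d*` part of the
      -- Laplacian absorbs the full term.
      have h2 : (A.card : ℝ) ≤ N := by
        rw [hN]; exact_mod_cast Finset.card_le_univ A
      have h3 : 0 ≤ c * ((‖F 0‖ ^ 2 + ‖F (-0)‖ ^ 2) / 2) := by positivity
      nlinarith [sq_nonneg ‖∑ v, f v‖]
    · rw [zero_add]
      refine (Complex.re_le_norm _).trans ?_
      simp only [norm_mul, RCLike.norm_conj, AddChar.norm_apply, mul_one]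
      rw [mul_assoc]
      refine mul_le_mul (hCle χ h) ?_ (by positivity) hc0
      nlinarith [sq_nonneg (‖F χ‖ - ‖F (-χ)‖)]
  have hbound := Finset.sum_le_sum fun χ (_ : χ ∈ Finset.univ) => hterm χ
  have hneg : ∑ χ : AddChar G ℂ, ‖F (-χ)‖ ^ 2 = ∑ χ, ‖F χ‖ ^ 2 :=
    Equiv.sum_comp (Equiv.neg (AddChar G ℂ)) fun χ => ‖F χ‖ ^ 2
  rw [← Complex.re_sum, ← hsum, Complex.re_ofReal_mul, Finset.sum_add_distrib, ← Finset.mul_sum,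
    ← Finset.sum_div, Finset.sum_add_distrib, hneg, sum_norm_sq_characterSum] at hbound
  simp only [Finset.sum_ite_eq', Finset.mem_univ, if_true] at hbound
  refine le_of_mul_le_mul_left (hbound.trans_eq ?_) hNpos
  ring

end Fourier

/-! ### Cochains as functions on all tuples -/

section Extension

theorem inner_self_eq_ofReal_norm_sq {E : Type*} [NormedAddCommGroup E] [InnerProductSpace ℂ E]
    (x : E) : inner ℂ x x = ((‖x‖ ^ 2 : ℝ) : ℂ) := by
  rw [inner_self_eq_norm_sq_to_K, Complex.ofReal_pow]
  rfl

variable {V : Type*} {X : PreAbstractSimplicialComplex V} {p : ℕ}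

theorem OrderedSimplex.coe_injective :
    Function.Injective fun (σ : OrderedSimplex X p) => (σ.1 : Fin p → V) :=
  fun _ _ h => Subtype.ext (DFunLike.coe_injective h)

/-- The extension of a cochain by zero to all tuples of vertices. -/
noncomputable def Cochain.extend (φ : Cochain X p) : (Fin p → V) → ℂ :=
  Function.extend (fun σ : OrderedSimplex X p => (σ.1 : Fin p → V)) φ 0

theorem Cochain.extend_coe (φ : Cochain X p) (σ : OrderedSimplex X p) :
    φ.extend σ.1 = φ σ :=
  OrderedSimplex.coe_injective.extend_apply _ _ σ

theorem Cochain.extend_of_forall_ne (φ : Cochain X p) {x : Fin p → V}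
    (hx : ∀ σ : OrderedSimplex X p, (σ.1 : Fin p → V) ≠ x) : φ.extend x = 0 :=
  Function.extend_apply' _ _ _ fun ⟨σ, h⟩ => hx σ h

theorem Cochain.isSkew_extend (φ : Cochain X p) : IsSkew φ.extend := by
  intro x π
  by_cases h : ∃ σ : OrderedSimplex X p, (σ.1 : Fin p → V) = x
  · obtain ⟨σ, rfl⟩ := h
    have : (σ.1 : Fin p → V) ∘ π = (σ.reorder π).1 := rfl
    rw [this, φ.extend_coe, φ.extend_coe, φ.2]
  · push Not at h
    rw [φ.extend_of_forall_ne h, mul_zero, φ.extend_of_forall_ne]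
    intro σ hσ
    refine h (σ.reorder π.symm) ?_
    change (σ.1 : Fin p → V) ∘ π.symm = x
    rw [hσ]
    funext i
    simp

theorem Cochain.extend_coboundary (φ : Cochain X p) (σ : OrderedSimplex X (p + 1)) :
    (coboundary X p φ).extend σ.1 = tupleCoboundary φ.extend σ.1 := by
  rw [Cochain.extend_coe]
  change ∑ i : Fin (p + 1), (-1 : ℂ) ^ (i : ℕ) * φ (σ.face i) = tupleCoboundary φ.extend σ.1
  refine Finset.sum_congr rfl fun i _ => ?_
  rw [← φ.extend_coe]
  rfl

theorem Simplex.map_orient (s : Simplex X p) : Finset.univ.map s.orient.1 = s.1 := by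
  change Finset.univ.map ((s.1.equivFinOfCardEq s.2.1).symm.toEmbedding.trans
    (Function.Embedding.subtype _)) = s.1
  rw [← Finset.map_map, Finset.map_univ_equiv]
  ext x
  simp

variable [Fintype V]

/-- Each simplex has `p!` orderings, and the two signs of a reordering multiply to one. -/
theorem Cochain.factorial_mul_inner (φ ψ : Cochain X p) :
    (p.factorial : ℂ) * inner ℂ φ ψ = ∑ x, conj (φ.extend x) * ψ.extend x := by
  have hinner : inner ℂ φ ψ = ∑ s : Simplex X p, conj (φ s.orient) * ψ s.orient := rfl
  let e : Simplex X p × Equiv.Perm (Fin p) → (Fin p → V) :=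
    fun q => ((q.1.orient.reorder q.2).1 : Fin p → V)
  have he : Function.Injective e := by
    rintro ⟨s, π⟩ ⟨s', π'⟩ h
    have h1 : ∀ (s : Simplex X p) (π : Equiv.Perm (Fin p)),
        Finset.univ.map (s.orient.reorder π).1 = s.1 := fun s π => by
      rw [← s.map_orient]
      change Finset.univ.map (π.toEmbedding.trans s.orient.1) = _
      rw [← Finset.map_map, Finset.map_univ_equiv]
    have h2 : s.orient.reorder π = s'.orient.reorder π' := OrderedSimplex.coe_injective h
    obtain rfl : s = s' := Subtype.ext (by rw [← h1 s π, h2, h1])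
    have h3 : π = π' := Equiv.ext fun i => s.orient.1.injective (congrFun h i)
    rw [h3]
  rw [hinner, Finset.mul_sum, ← Fintype.sum_of_injective e he
    (fun q => conj (φ q.1.orient) * ψ q.1.orient), Fintype.sum_prod_type]
  · simp [Fintype.card_perm]
  · intro x hx
    rw [ψ.extend_of_forall_ne, mul_zero]
    rintro σ rfl
    obtain ⟨s, π, rfl⟩ := exists_orient σ
    exact hx ⟨(s, π), rfl⟩
  · rintro ⟨s, π⟩
    simp only [e, Cochain.extend_coe]
    rw [φ.2, ψ.2]
    have : (((Equiv.Perm.sign π : ℤ) : ℂ)) * ((Equiv.Perm.sign π : ℤ) : ℂ) = 1 := by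
      rcases Int.units_eq_one_or (Equiv.Perm.sign π) with h | h <;> simp [h]
    rw [map_mul, map_intCast]
    linear_combination (-(conj (φ s.orient) * ψ s.orient)) * this

theorem Cochain.factorial_mul_norm_sq (φ : Cochain X p) :
    (p.factorial : ℝ) * ‖φ‖ ^ 2 = ∑ x, ‖φ.extend x‖ ^ 2 := by
  have h := φ.factorial_mul_inner φ
  rw [inner_self_eq_ofReal_norm_sq] at h
  simp_rw [Complex.conj_mul'] at h
  exact_mod_cast h

end Extension

/-! ### The Laplacian of a sum complex -/

section SumComplex

variable {G : Type*} [AddCommGroup G] {A : Finset G} {j : ℕ}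

theorem exists_orderedSimplex_coe_eq {p : ℕ} (hp : p ≤ j) {x : Fin p → G}
    (hx : Function.Injective x) : ∃ σ : OrderedSimplex (sumComplex A j) p, (σ.1 : Fin p → G) = x :=
  ⟨⟨⟨x, hx⟩, fun h => ⟨h, Or.inl (by simpa using hp)⟩⟩, rfl⟩

theorem exists_orderedSimplex_coe_eq_iff {x : Fin (j + 1) → G} (hx : Function.Injective x) :
    (∃ σ : OrderedSimplex (sumComplex A j) (j + 1), (σ.1 : Fin (j + 1) → G) = x) ↔
      ∑ i, x i ∈ A := by
  constructor
  · rintro ⟨σ, rfl⟩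
    obtain ⟨-, h | ⟨-, h⟩⟩ := σ.2 (by simp)
    · simp at h
    · simpa using h
  · intro h
    exact ⟨⟨⟨x, hx⟩, fun h' => ⟨h', Or.inr ⟨by simp, by simpa using h⟩⟩⟩, rfl⟩

theorem Cochain.extend_coboundary_sumComplex (φ : Cochain (sumComplex A j) j)
    (x : Fin (j + 1) → G) :
    (coboundary _ j φ).extend x =
      Set.indicator (A : Set G) 1 (∑ i, x i) * tupleCoboundary φ.extend x := by
  by_cases hx : Function.Injective x
  · by_cases hA : ∑ i, x i ∈ A
    · obtain ⟨σ, rfl⟩ := (exists_orderedSimplex_coe_eq_iff hx).2 hA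
      rw [Cochain.extend_coboundary, Set.indicator_of_mem (by simpa using hA)]
      simp
    · rw [Cochain.extend_of_forall_ne, Set.indicator_of_notMem (by simpa using hA), zero_mul]
      intro σ hσ
      exact hA ((exists_orderedSimplex_coe_eq_iff hx).1 ⟨σ, hσ⟩)
  · rw [(Cochain.isSkew_extend _).eq_zero_of_not_injective hx,
      φ.isSkew_extend.coboundary.eq_zero_of_not_injective hx, mul_zero]

variable [Fintype G]

/-- The skew-symmetric function `z ↦ ∑ u, φ(u, z)`. -/
noncomputable def Cochain.contract (φ : Cochain (sumComplex A (j + 1)) (j + 1)) :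
    Cochain (sumComplex A (j + 1)) j :=
  ⟨fun σ => ∑ u : G, φ.extend (Fin.cons u σ.1), fun σ π => by
    rw [Finset.mul_sum]
    exact Finset.sum_congr rfl fun u _ => φ.isSkew_extend.apply_cons u σ.1 π⟩

theorem Cochain.extend_contract (φ : Cochain (sumComplex A (j + 1)) (j + 1)) (z : Fin j → G) :
    φ.contract.extend z = ∑ u : G, φ.extend (Fin.cons u z) := by
  by_cases hz : Function.Injective z
  · obtain ⟨σ, rfl⟩ := exists_orderedSimplex_coe_eq (A := A) j.le_succ hz
    exact φ.contract.extend_coe σ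
  · rw [φ.contract.isSkew_extend.eq_zero_of_not_injective hz]
    exact (Finset.sum_eq_zero fun u _ =>
      (φ.isSkew_extend.apply_cons u).eq_zero_of_not_injective hz).symm

/-- Fullness of the skeleton matters here: every injective tuple of length at most `j + 1` is a
simplex, so the contraction is an unrestricted sum over `u`. -/
theorem adjoint_coboundary_apply (φ : Cochain (sumComplex A (j + 1)) (j + 1)) :
    LinearMap.adjoint (coboundary (sumComplex A (j + 1)) j) φ = φ.contract := by
  refine ext_inner_left ℂ fun ψ => ?_
  rw [LinearMap.adjoint_inner_right]
  have hj : ((j + 1).factorial : ℂ) ≠ 0 := by exact_mod_cast (j + 1).factorial_ne_zero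
  refine mul_left_cancel₀ hj ?_
  have h1 : ((j + 1).factorial : ℂ) * inner ℂ ψ φ.contract =
      (j + 1) * ∑ z, conj (ψ.extend z) * φ.contract.extend z := by
    rw [← Cochain.factorial_mul_inner, Nat.factorial_succ]
    push_cast
    ring
  have h2 : ∀ x, conj ((coboundary _ j ψ).extend x) * φ.extend x =
      φ.extend x * conj (tupleCoboundary ψ.extend x) := by
    intro x
    by_cases hx : Function.Injective x
    · obtain ⟨σ, rfl⟩ := exists_orderedSimplex_coe_eq (A := A) le_rfl hx
      rw [Cochain.extend_coboundary, mul_comm]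
    · simp [φ.isSkew_extend.eq_zero_of_not_injective hx]
  rw [h1, Cochain.factorial_mul_inner, Finset.sum_congr rfl fun x _ => h2 x,
    φ.isSkew_extend.sum_mul_conj_tupleCoboundary, Finset.sum_comm]
  congr 1
  refine Finset.sum_congr rfl fun z _ => ?_
  rw [Cochain.extend_contract, Finset.mul_sum]
  exact Finset.sum_congr rfl fun u _ => mul_comm _ _

theorem inner_laplacian (φ : Cochain (sumComplex A (j + 1)) (j + 1)) :
    inner ℂ φ (laplacian _ j φ) =
      ((‖φ.contract‖ ^ 2 + ‖coboundary (sumComplex A (j + 1)) (j + 1) φ‖ ^ 2 : ℝ) : ℂ) := by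
  rw [laplacian, LinearMap.add_apply, inner_add_right, LinearMap.comp_apply, LinearMap.comp_apply,
    adjoint_coboundary_apply,
    ← LinearMap.adjoint_inner_left (coboundary (sumComplex A (j + 1)) j), adjoint_coboundary_apply,
    LinearMap.adjoint_inner_right, inner_self_eq_ofReal_norm_sq, inner_self_eq_ofReal_norm_sq,
    Complex.ofReal_add]

/-- The indicator is idempotent, so one of its two copies can be dropped and a plain coboundary
moved across the pairing. The diagonal term collects `∑ u, 1_A(u + s) = |A|`; the rest is the cross
form. -/
theorem Cochain.factorial_mul_norm_coboundary_sq (φ : Cochain (sumComplex A (j + 1)) (j + 1)) :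
    ((j + 1).factorial : ℂ) * ((‖coboundary (sumComplex A (j + 1)) (j + 1) φ‖ ^ 2 : ℝ) : ℂ) =
      A.card * ∑ y, φ.extend y * conj (φ.extend y) -
        (j + 1) * conj (∑ z : Fin j → G, ∑ u, ∑ v, Set.indicator (A : Set G) 1
          (u + (v + ∑ i, z i)) * (φ.extend (Fin.cons v z) * conj (φ.extend (Fin.cons u z)))) := by
  classical
  set f := φ.extend with hf
  have hskew : IsSkew f := φ.isSkew_extend
  let w : G → ℂ := Set.indicator (A : Set G) 1
  have hwconj : ∀ g, conj (w g) = w g := fun g => by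
    by_cases h : g ∈ (A : Set G) <;> simp [w, h]
  have hwsq : ∀ g, w g * w g = w g := fun g => by
    by_cases h : g ∈ (A : Set G) <;> simp [w, h]
  have hwsum : ∀ s, ∑ u, w (u + s) = A.card := fun s => by
    rw [show ∑ u, w (u + s) = ∑ u, w u from Equiv.sum_comp (Equiv.addRight s) w]
    simp [w, Set.indicator_apply]
  set g := (coboundary (sumComplex A (j + 1)) (j + 1) φ).extend with hg
  have hgx : ∀ x, g x = w (∑ i, x i) * tupleCoboundary f x := φ.extend_coboundary_sumComplex
  have hgskew : IsSkew g := Cochain.isSkew_extend _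
  have h1 : ((j + 1 + 1).factorial : ℂ) *
      ((‖coboundary (sumComplex A (j + 1)) (j + 1) φ‖ ^ 2 : ℝ) : ℂ) =
        ∑ x, g x * conj (tupleCoboundary f x) := by
    rw [← inner_self_eq_ofReal_norm_sq, Cochain.factorial_mul_inner, ← hg]
    refine Finset.sum_congr rfl fun x _ => ?_
    rw [hgx, map_mul, hwconj]
    linear_combination (tupleCoboundary f x * conj (tupleCoboundary f x)) * hwsq (∑ i, x i)
  have h2 : ∀ u : G, ∑ y, w (u + ∑ i, y i) *
      (tupleCoboundary (fun z => f (Fin.cons u z)) y * conj (f y)) =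
        (j + 1) * conj (∑ v, ∑ z : Fin j → G, w (u + (v + ∑ i, z i)) *
          (f (Fin.cons v z) * conj (f (Fin.cons u z)))) := by
    intro u
    -- The weight depends only on the symmetric quantity `∑ i, y i`, so skewness survives and the
    -- pairing formula applies a second time.
    have hs : IsSkew fun y : Fin (j + 1) → G => w (u + ∑ i, y i) * f y := by
      intro y π
      simp only [Function.comp_apply, Equiv.sum_comp π y, hskew y π]
      ring
    have h3 := congrArg conj (hs.sum_mul_conj_tupleCoboundary fun z => f (Fin.cons u z))
    rw [map_sum, map_mul] at h3
    have h4 : conj ((j : ℂ) + 1) = j + 1 := by simp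
    rw [h4] at h3
    have h5 : ∀ (v : G) (z : Fin j → G),
        ∑ i, (Fin.cons v z : Fin (j + 1) → G) i = v + ∑ i, z i := fun v z => by
      simp [Fin.sum_univ_succ]
    simp only [h5, mul_assoc] at h3
    rw [← h3]
    refine Finset.sum_congr rfl fun y _ => ?_
    simp only [map_mul, hwconj, Complex.conj_conj]
    ring
  have h3 : ∑ x, g x * conj (tupleCoboundary f x) = (j + 1 + 1) *
      (A.card * ∑ y, f y * conj (f y) -
        (j + 1) * conj (∑ z : Fin j → G, ∑ u, ∑ v, w
          (u + (v + ∑ i, z i)) * (f (Fin.cons v z) * conj (f (Fin.cons u z))))) := by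
    rw [hgskew.sum_mul_conj_tupleCoboundary]
    push_cast
    congr 1
    have h4 : ∀ (u : G) (y : Fin (j + 1) → G), g (Fin.cons u y) * conj (f y) =
        w (u + ∑ i, y i) * (f y * conj (f y)) -
          w (u + ∑ i, y i) * (tupleCoboundary (fun z => f (Fin.cons u z)) y * conj (f y)) := by
      intro u y
      rw [hgx, tupleCoboundary_cons, Fin.sum_univ_succ]
      simp only [Fin.cons_zero, Fin.cons_succ]
      ring
    simp only [h4, Finset.sum_sub_distrib, h2]
    congr 1
    · rw [Finset.sum_comm, Finset.mul_sum]
      refine Finset.sum_congr rfl fun y _ => ?_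
      rw [← Finset.sum_mul, hwsum]
    · rw [← Finset.mul_sum, ← map_sum]
      congr 2
      rw [Finset.sum_congr rfl fun u _ => Finset.sum_comm, Finset.sum_comm]
  rw [← h1, Nat.factorial_succ (j + 1)] at h3
  push_cast at h3 ⊢
  have h5 : (j : ℂ) + 1 + 1 ≠ 0 := by exact_mod_cast (j + 1).succ_ne_zero
  refine mul_left_cancel₀ h5 ?_
  rw [← h3]
  ring

/-- The quadratic form of the Laplacian is bounded below in terms of the nontrivial Fourier
coefficients of the indicator function of `A`. -/
theorem mul_norm_sq_le_re_inner_laplacian {c : ℝ} (hc0 : 0 ≤ c)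
    (hc : ∀ χ : AddChar G ℂ, χ ≠ 0 → ‖∑ a ∈ A, χ a‖ ≤ c)
    (φ : Cochain (sumComplex A (j + 1)) (j + 1)) :
    (A.card - (j + 1) * c) * ‖φ‖ ^ 2 ≤ (inner ℂ φ (laplacian _ j φ)).re := by
  rw [inner_laplacian, Complex.ofReal_re]
  have h1 := congrArg Complex.re φ.factorial_mul_norm_coboundary_sq
  have h2 : ∑ y, φ.extend y * conj (φ.extend y) = (((j + 1).factorial * ‖φ‖ ^ 2 : ℝ) : ℂ) := by
    rw [φ.factorial_mul_norm_sq]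
    simp [Complex.mul_conj']
  have h3 := Finset.sum_le_sum fun (z : Fin j → G) (_ : z ∈ Finset.univ) =>
    sum_sum_indicator_le A hc0 hc (∑ i, z i) fun u => φ.extend (Fin.cons u z)
  rw [Finset.sum_add_distrib, ← Finset.mul_sum, ← Complex.re_sum] at h3
  have h4 : ∑ z : Fin j → G, ∑ v, ‖φ.extend (Fin.cons v z)‖ ^ 2 =
      (j + 1).factorial * ‖φ‖ ^ 2 := by
    rw [φ.factorial_mul_norm_sq, sum_tuple_succ, Finset.sum_comm]
  have h5 : ∑ z : Fin j → G, ‖∑ v, φ.extend (Fin.cons v z)‖ ^ 2 =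
      j.factorial * ‖φ.contract‖ ^ 2 := by
    rw [φ.contract.factorial_mul_norm_sq]
    simp only [Cochain.extend_contract]
  have h6 : ((j : ℂ) + 1) = (((j : ℝ) + 1 : ℝ) : ℂ) := by push_cast; rfl
  have h7 : ((j + 1).factorial : ℂ) = (((j + 1).factorial : ℝ) : ℂ) := by push_cast; rfl
  have h8 : (A.card : ℂ) = ((A.card : ℝ) : ℂ) := by push_cast; rfl
  rw [h2, h6, h7, h8, Complex.sub_re, Complex.re_ofReal_mul, Complex.re_ofReal_mul,
    Complex.re_ofReal_mul, Complex.conj_re, Complex.ofReal_re, Complex.ofReal_re] at h1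
  rw [h4, h5] at h3
  have h9 : ((j + 1).factorial : ℝ) = (j + 1) * j.factorial := by
    rw [Nat.factorial_succ]; push_cast; rfl
  have h10 : (0 : ℝ) < (j + 1).factorial := by exact_mod_cast (j + 1).factorial_pos
  have hj : (0 : ℝ) ≤ (j : ℝ) + 1 := by positivity
  have h11 := mul_le_mul_of_nonneg_left h3 hj
  -- The trivial-character loss equals the contraction term exactly, with no constant left over.
  have h12 : ((j : ℝ) + 1) * (j.factorial * ‖φ.contract‖ ^ 2) =
      (j + 1).factorial * ‖φ.contract‖ ^ 2 := by rw [h9]; ring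
  refine le_of_mul_le_mul_left ?_ h10
  rw [mul_add, h12] at h11
  rw [mul_add]
  linarith

/-- Antisymmetrising the point mass at one injective tuple gives a nonzero cochain. This guarantees
an eigenvalue, so that the gap is not the infimum of an empty set. -/
theorem nontrivial_cochain (hj : j < Fintype.card G) :
    Nontrivial (Cochain (sumComplex A (j + 1)) (j + 1)) := by
  classical
  obtain ⟨x⟩ : Nonempty (Fin (j + 1) ↪ G) :=
    Function.Embedding.nonempty_of_card_le (by simpa using hj)
  let φ : Cochain (sumComplex A (j + 1)) (j + 1) :=
    ⟨fun τ => ∑ π : Equiv.Perm (Fin (j + 1)),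
      ((Equiv.Perm.sign π : ℤ) : ℂ) * if x ∘ π = τ.1 then 1 else 0, fun τ ρ => by
      change ∑ π : Equiv.Perm (Fin (j + 1)), ((Equiv.Perm.sign π : ℤ) : ℂ) *
          (if x ∘ π = (τ.reorder ρ).1 then 1 else 0) = ((Equiv.Perm.sign ρ : ℤ) : ℂ) *
        ∑ π : Equiv.Perm (Fin (j + 1)), ((Equiv.Perm.sign π : ℤ) : ℂ) *
          (if x ∘ π = τ.1 then 1 else 0)
      rw [← Equiv.sum_comp (Equiv.mulRight ρ), Finset.mul_sum]
      refine Finset.sum_congr rfl fun π _ => ?_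
      have h1 : (x ∘ (π * ρ) = ((τ.reorder ρ).1 : Fin (j + 1) → G)) ↔
          x ∘ π = (τ.1 : Fin (j + 1) → G) := by
        change (x ∘ π) ∘ ρ = τ.1 ∘ ρ ↔ _
        exact ρ.surjective.injective_comp_right.eq_iff
      simp only [Equiv.coe_mulRight, h1, Equiv.Perm.sign_mul]
      push_cast
      ring⟩
  obtain ⟨σ, hσ⟩ := exists_orderedSimplex_coe_eq (A := A) le_rfl x.injective
  have hφ : φ σ = 1 := by
    change ∑ π : Equiv.Perm (Fin (j + 1)),
      ((Equiv.Perm.sign π : ℤ) : ℂ) * (if x ∘ π = σ.1 then 1 else 0) = 1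
    rw [Finset.sum_eq_single 1, hσ]
    · simp
    · intro π _ hπ
      rw [if_neg, mul_zero]
      rw [hσ]
      intro h
      exact hπ (Equiv.ext fun i => x.injective (congrFun h i))
    · simp
  refine nontrivial_of_ne φ 0 fun h => ?_
  rw [h] at hφ
  exact zero_ne_one hφ

theorem le_spectralGap {r : ℝ} (hj : j < Fintype.card G)
    (h : ∀ φ : Cochain (sumComplex A (j + 1)) (j + 1),
      r * ‖φ‖ ^ 2 ≤ (inner ℂ φ (laplacian _ j φ)).re) :
    r ≤ spectralGap (sumComplex A (j + 1)) j := by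
  have := nontrivial_cochain (A := A) hj
  have heig : ∀ (μ : ℂ) (φ : Cochain (sumComplex A (j + 1)) (j + 1)),
      Module.End.HasEigenvector (laplacian _ j) μ φ →
        inner ℂ φ (laplacian _ j φ) = μ * ((‖φ‖ ^ 2 : ℝ) : ℂ) := fun μ φ hφ => by
    rw [hφ.apply_eq_smul, inner_smul_right, inner_self_eq_ofReal_norm_sq]
  have hpos : ∀ (μ : ℂ) (φ : Cochain (sumComplex A (j + 1)) (j + 1)),
      Module.End.HasEigenvector (laplacian _ j) μ φ → 0 < ‖φ‖ ^ 2 := fun μ φ hφ =>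
    pow_pos (norm_pos_iff.2 hφ.2) 2
  refine le_csInf ?_ ?_
  · obtain ⟨μ, hμ⟩ := Module.End.exists_eigenvalue (laplacian (sumComplex A (j + 1)) j)
    obtain ⟨φ, hφ⟩ := hμ.exists_hasEigenvector
    have h1 := heig μ φ hφ
    rw [inner_laplacian] at h1
    have h2 := hpos μ φ hφ
    -- The complex eigenvalue is forced to equal this Rayleigh quotient, hence is real.
    refine ⟨(‖φ.contract‖ ^ 2 + ‖coboundary (sumComplex A (j + 1)) (j + 1) φ‖ ^ 2) / ‖φ‖ ^ 2, ?_⟩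
    have h3 : ((‖φ‖ ^ 2 : ℝ) : ℂ) ≠ 0 := by exact_mod_cast h2.ne'
    rwa [Set.mem_ofPred_eq, Complex.ofReal_div, h1, mul_div_cancel_right₀ _ h3]
  · intro μ hμ
    obtain ⟨φ, hφ⟩ := Module.End.HasEigenvalue.exists_hasEigenvector hμ
    have h1 := h φ
    rw [heig _ φ hφ, ← Complex.ofReal_mul, Complex.ofReal_re] at h1
    exact le_of_mul_le_mul_right h1 (hpos _ φ hφ)

theorem spectralGap_nonneg (hj : j < Fintype.card G) :
    0 ≤ spectralGap (sumComplex A (j + 1)) j :=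
  le_spectralGap hj fun φ => by
    rw [inner_laplacian, Complex.ofReal_re, zero_mul]
    positivity

/-- The spectral gap of a sum complex is at least `|A|` minus `j + 1` times the largest
nontrivial Fourier coefficient of the indicator function of `A`. -/
theorem card_sub_le_spectralGap (hj : j < Fintype.card G) {c : ℝ} (hc0 : 0 ≤ c)
    (hc : ∀ χ : AddChar G ℂ, χ ≠ 0 → ‖∑ a ∈ A, χ a‖ ≤ c) :
    A.card - (j + 1) * c ≤ spectralGap (sumComplex A (j + 1)) j :=
  le_spectralGap hj (mul_norm_sq_le_re_inner_laplacian hc0 hc)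

end SumComplex

/-! ### A Hilbert space Hoeffding inequality -/

section Concentration

/-- `y ↦ cosh (c √y)` is convex on `[0, ∞)`. -/
theorem convexOn_cosh_mul_sqrt (c : ℝ) :
    ConvexOn ℝ (Set.Ici 0) fun y => Real.cosh (c * √y) := by
  have hs : ∀ y : ℝ, 0 ≤ y →
      -- In the variable `y` the power series has nonnegative coefficients, so convexity holds term
      -- by term.
      HasSum (fun n : ℕ => c ^ (2 * n) / (2 * n).factorial * y ^ n) (Real.cosh (c * √y)) := by
    intro y hy
    convert Real.hasSum_cosh (c * √y) using 2 with n
    rw [mul_pow, pow_mul (√y), Real.sq_sqrt hy]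
    ring
  refine ⟨convex_Ici 0, fun x hx y hy a b ha hb hab => ?_⟩
  have hxy : 0 ≤ a • x + b • y := (convex_Ici (0 : ℝ)) hx hy ha hb hab
  refine hasSum_le (fun n => ?_) (hs _ hxy)
    (((hs x hx).mul_left a).add ((hs y hy).mul_left b))
  have h1 := (convexOn_pow (𝕜 := ℝ) n).2 hx hy ha hb hab
  have h2 : 0 ≤ c ^ (2 * n) / (2 * n).factorial := by
    rw [pow_mul]; positivity
  simp only [smul_eq_mul] at h1 ⊢
  nlinarith [mul_le_mul_of_nonneg_left h1 h2]

variable {E : Type*} [NormedAddCommGroup E] [InnerProductSpace ℝ E]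

/-- Adding a centred random unit vector to `s` multiplies the mean of `cosh (c‖·‖)` by at most
`cosh c`. -/
theorem sum_cosh_norm_add_le {ι : Type*} [Fintype ι] (c : ℝ) (s : E) (z : ι → E)
    (hz : ∀ i, ‖z i‖ = 1) (hsum : ∑ i, z i = 0) :
    ∑ i, Real.cosh (c * ‖s + z i‖) ≤ Fintype.card ι * (Real.cosh c * Real.cosh (c * ‖s‖)) := by
  rcases eq_or_ne s 0 with rfl | hs
  · simp [hz]
  set r := ‖s‖ with hr
  have hrpos : 0 < r := norm_pos_iff.2 hs
  let t : ι → ℝ := fun i => inner ℝ s (z i)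
  have htsum : ∑ i, t i = 0 := by
    simp only [t, ← inner_sum, hsum, inner_zero_right]
  have hle : ∀ i, Real.cosh (c * ‖s + z i‖) ≤
      Real.cosh c * Real.cosh (c * r) + t i / r * (Real.sinh c * Real.sinh (c * r)) := by
    intro i
    have ht : |t i| ≤ r := by
      have := abs_real_inner_le_norm s (z i)
      rwa [hz, mul_one] at this
    obtain ⟨h1, h2⟩ := abs_le.1 ht
    -- `‖s + z i‖²` is a convex combination of `(r + 1)²` and `(r - 1)²`, with weights in range by
    -- Cauchy-Schwarz. The resulting bound is affine in `t i`, so it averages well.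
    have h3 := (convexOn_cosh_mul_sqrt c).2
      (show (r + 1) ^ 2 ∈ Set.Ici 0 from Set.mem_Ici.2 (sq_nonneg _))
      (show (r - 1) ^ 2 ∈ Set.Ici 0 from Set.mem_Ici.2 (sq_nonneg _))
      (show 0 ≤ (1 + t i / r) / 2 by
        have : -1 ≤ t i / r := by rw [le_div_iff₀ hrpos]; linarith
        linarith)
      (show 0 ≤ (1 - t i / r) / 2 by
        have : t i / r ≤ 1 := by rw [div_le_iff₀ hrpos]; linarith
        linarith)
      (by ring)
    have h4 : ((1 + t i / r) / 2) • (r + 1) ^ 2 + ((1 - t i / r) / 2) • (r - 1) ^ 2 =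
        ‖s + z i‖ ^ 2 := by
      rw [norm_add_sq_real, hz, ← hr]
      simp only [smul_eq_mul]
      change _ = r ^ 2 + 2 * t i + 1 ^ 2
      field_simp
      ring
    simp only [h4] at h3
    rw [Real.sqrt_sq (norm_nonneg _), Real.sqrt_sq (by positivity),
      Real.sqrt_sq_eq_abs] at h3
    have h5 : Real.cosh (c * |r - 1|) = Real.cosh (c * (r - 1)) := by
      rcases abs_choice (r - 1) with h | h <;> rw [h]
      rw [mul_neg, Real.cosh_neg]
    rw [h5, mul_add, mul_sub, mul_one, Real.cosh_add, Real.cosh_sub] at h3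
    refine h3.trans_eq ?_
    simp only [smul_eq_mul]
    ring
  refine (Finset.sum_le_sum fun i _ => hle i).trans_eq ?_
  have h0 : ∑ i, t i / r * (Real.sinh c * Real.sinh (c * r)) = 0 := by
    rw [← Finset.sum_mul, ← Finset.sum_div, htsum]
    simp
  rw [Finset.sum_add_distrib, h0]
  simp

theorem sum_cosh_norm_sum_le {ι : Type*} [Fintype ι] (c : ℝ) (z : ι → E)
    (hz : ∀ i, ‖z i‖ = 1) (hsum : ∑ i, z i = 0) (m : ℕ) :
    ∑ a : Fin m → ι, Real.cosh (c * ‖∑ i, z (a i)‖) ≤ (Fintype.card ι * Real.cosh c) ^ m := by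
  induction m with
  | zero => simp
  | succ m ih =>
    rw [← (Fin.consEquiv fun _ : Fin (m + 1) => ι).sum_comp, Fintype.sum_prod_type,
      Finset.sum_comm]
    simp only [Fin.consEquiv_apply, Fin.sum_univ_succ, Fin.cons_zero, Fin.cons_succ]
    calc _ ≤ ∑ a : Fin m → ι,
        Fintype.card ι * (Real.cosh c * Real.cosh (c * ‖∑ i, z (a i)‖)) := by
          refine Finset.sum_le_sum fun a _ => ?_
          simpa only [add_comm] using sum_cosh_norm_add_le c (∑ i, z (a i)) z hz hsum
      _ = (Fintype.card ι * Real.cosh c) * ∑ a : Fin m → ι, Real.cosh (c * ‖∑ i, z (a i)‖) := by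
          rw [Finset.mul_sum]
          exact Finset.sum_congr rfl fun a _ => by ring
      _ ≤ _ := by
          rw [pow_succ']
          exact mul_le_mul_of_nonneg_left ih (by positivity)

open Classical in
/-- Hoeffding's inequality in a Hilbert space, for sums of independent uniform choices from a
centred family of unit vectors. -/
theorem card_norm_sum_ge_le {ι : Type*} [Fintype ι] (z : ι → E)
    (hz : ∀ i, ‖z i‖ = 1) (hsum : ∑ i, z i = 0) {m : ℕ} (hm : 0 < m) {t : ℝ} (ht : 0 ≤ t) :
    ((Finset.univ.filter fun a : Fin m → ι => t ≤ ‖∑ i, z (a i)‖).card : ℝ) ≤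
      2 * Fintype.card ι ^ m * Real.exp (-(t ^ 2 / (2 * m))) := by
  have hm' : (0 : ℝ) < m := by exact_mod_cast hm
  -- This choice minimises the Chernoff exponent `m c² / 2 - c t`.
  set c := t / m with hc
  have hc0 : 0 ≤ c := by positivity
  set S := Finset.univ.filter fun a : Fin m → ι => t ≤ ‖∑ i, z (a i)‖
  have h1 : (S.card : ℝ) * (Real.exp (c * t) / 2) ≤
      (Fintype.card ι * Real.cosh c) ^ m := by
    refine le_trans ?_ (sum_cosh_norm_sum_le c z hz hsum m)
    rw [← nsmul_eq_mul]
    refine le_trans (Finset.card_nsmul_le_sum S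
      (fun a => Real.cosh (c * ‖∑ i, z (a i)‖)) _ fun a ha => ?_)
      (Finset.sum_le_sum_of_subset_of_nonneg (Finset.subset_univ _)
        fun _ _ _ => (Real.cosh_pos _).le)
    have h2 : t ≤ ‖∑ i, z (a i)‖ := (Finset.mem_filter.1 ha).2
    have h3 : Real.exp (c * t) ≤ Real.exp (c * ‖∑ i, z (a i)‖) :=
      Real.exp_le_exp.2 (mul_le_mul_of_nonneg_left h2 hc0)
    rw [Real.cosh_eq]
    linarith [Real.exp_pos (-(c * ‖∑ i, z (a i)‖))]
  have h2 : (Fintype.card ι * Real.cosh c) ^ m ≤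
      Fintype.card ι ^ m * Real.exp (t ^ 2 / (2 * m)) := by
    rw [mul_pow]
    refine mul_le_mul_of_nonneg_left ?_ (by positivity)
    calc Real.cosh c ^ m ≤ Real.exp (c ^ 2 / 2) ^ m :=
          pow_le_pow_left₀ (Real.cosh_pos _).le (Real.cosh_le_exp_half_sq c) m
      _ = Real.exp (t ^ 2 / (2 * m)) := by
          rw [← Real.exp_nat_mul, hc]
          congr 1
          field_simp
  have h3 : Real.exp (c * t) = Real.exp (t ^ 2 / (2 * m)) * Real.exp (t ^ 2 / (2 * m)) := by
    rw [← Real.exp_add, hc]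
    congr 1
    field_simp
    ring
  rw [Real.exp_neg, ← div_eq_mul_inv, le_div_iff₀ (Real.exp_pos _)]
  refine le_of_mul_le_mul_right ?_ (Real.exp_pos (t ^ 2 / (2 * m)))
  rw [h3] at h1
  linarith

end Concentration

/-! ### From tuples to subsets, and numerical estimates -/

section Counting

/-- A birthday bound: `m` uniform draws collide with probability at most `m(m - 1)/(2n)`. -/
theorem pow_mul_one_sub_le_descFactorial {n m : ℕ} (hmn : m ≤ n) :
    (n : ℝ) ^ m * (1 - m * (m - 1) / (2 * n)) ≤ n.descFactorial m := by
  induction m with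
  | zero => simp
  | succ m ih =>
    have ih' := ih (Nat.le_of_succ_le hmn)
    have hn : (0 : ℝ) < n := by exact_mod_cast (Nat.succ_pos m).trans_le hmn
    have hm : (m : ℝ) ≤ n := by exact_mod_cast Nat.le_of_succ_le hmn
    have hm0 : (0 : ℝ) ≤ m * (m - 1) := by
      rcases m.eq_zero_or_pos with rfl | h
      · simp
      · have : (1 : ℝ) ≤ m := by exact_mod_cast h
        exact mul_nonneg (by linarith) (by linarith)
    rw [Nat.descFactorial_succ, Nat.cast_mul, Nat.cast_sub (Nat.le_of_succ_le hmn)]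
    refine le_trans ?_ (mul_le_mul_of_nonneg_left ih' (sub_nonneg.2 hm))
    have h1 : ((n : ℝ) - m) * (n ^ m * (1 - m * (m - 1) / (2 * n))) -
        (n : ℝ) ^ (m + 1) * (1 - ((m + 1 : ℕ) : ℝ) * (((m + 1 : ℕ) : ℝ) - 1) / (2 * n)) =
        n ^ m * (m * (m * (m - 1)) / (2 * n)) := by
      push_cast
      field_simp
      ring
    have h2 : 0 ≤ (n : ℝ) ^ m * (m * (m * (m - 1)) / (2 * n)) := by positivity
    linarith

theorem four_mul_sq_mul_log_div_le {n k ε : ℝ} (hk : 0 < k) (hε : 0 < ε)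
    (hn : 2 ^ 10 * k ^ 8 / ε ^ 8 < n) :
    4 * k ^ 2 * Real.log n / ε ^ 2 ≤ 1.05 * √n := by
  have hn0 : 0 < n := lt_trans (by positivity) hn
  set b := √(√n) with hb
  have hbpos : 0 < b := Real.sqrt_pos.2 (Real.sqrt_pos.2 hn0)
  have hb2 : b ^ 2 = √n := Real.sq_sqrt (Real.sqrt_nonneg _)
  have hb4 : b ^ 4 = n := by
    rw [show b ^ 4 = (b ^ 2) ^ 2 by ring, hb2, Real.sq_sqrt hn0.le]
  have hlog : Real.log n = 4 * Real.log b := by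
    rw [← hb4, Real.log_pow]
    norm_num
  set a := k ^ 2 / ε ^ 2 with ha
  have ha0 : 0 < a := by positivity
  -- Fourth root of the hypothesis, with `5.65 < 2 ^ (5/2)`. Combined with `log b ≤ b / e`, the
  -- final constant is `16 / (5.65 * 2.718) < 1.05`.
  have hab : 5.65 * a ≤ b := by
    refine le_of_pow_le_pow_left₀ (n := 4) (by norm_num) hbpos.le ?_
    have h1 : 2 ^ 10 * a ^ 4 = 2 ^ 10 * k ^ 8 / ε ^ 8 := by
      rw [ha]; field_simp
    rw [← h1] at hn
    rw [hb4, mul_pow]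
    have : (0 : ℝ) < a ^ 4 := by positivity
    norm_num at hn ⊢
    linarith
  have hlogb : Real.log b ≤ b / 2.718 := by
    have h1 := Real.log_le_sub_one_of_pos (show 0 < b / Real.exp 1 by positivity)
    rw [Real.log_div hbpos.ne' (Real.exp_ne_zero 1), Real.log_exp] at h1
    have h2 : b / Real.exp 1 ≤ b / 2.718 :=
      div_le_div_of_nonneg_left hbpos.le (by norm_num)
        (by linarith [Real.exp_one_gt_d9])
    linarith
  have h1 : 4 * k ^ 2 * Real.log n / ε ^ 2 = 16 * (a * Real.log b) := by
    rw [hlog, ha]; ring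
  have h2 : a * Real.log b ≤ (b / 5.65) * (b / 2.718) :=
    (mul_le_mul_of_nonneg_left hlogb ha0.le).trans
      (mul_le_mul_of_nonneg_right (by rw [le_div_iff₀ (by norm_num)]; linarith) (by positivity))
  rw [h1, ← hb2]
  have h3 : (b / 5.65) * (b / 2.718) = b ^ 2 / (5.65 * 2.718) := by
    field_simp
  rw [h3] at h2
  have h4 : b ^ 2 / (5.65 * 2.718) ≤ b ^ 2 * (1.05 / 16) := by
    rw [div_eq_mul_inv]
    exact mul_le_mul_of_nonneg_left (by norm_num) (by positivity)
  linarith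

theorem factorial_mul_card_le {V : Type*} [Nonempty V] {m : ℕ} {S : Finset (Finset V)}
    (hS : ∀ s ∈ S, s.card = m) {T : Finset (Fin m → V)}
    (hT : ∀ x : Fin m ↪ V, Finset.univ.map x ∈ S → ⇑x ∈ T) :
    m.factorial * S.card ≤ T.card := by
  classical
  have hex : ∀ s ∈ S, ∃ x : Fin m → V, ∃ h : Function.Injective x,
      Finset.univ.map ⟨x, h⟩ = s := fun s hs => by
    let e := s.equivFinOfCardEq (hS s hs)
    refine ⟨fun i => e.symm i, Subtype.val_injective.comp e.symm.injective, ?_⟩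
    ext v
    simp only [Finset.mem_map, Finset.mem_univ, true_and, Function.Embedding.coeFn_mk]
    exact ⟨fun ⟨i, hi⟩ => hi ▸ (e.symm i).2, fun hv => ⟨e ⟨v, hv⟩, by simp⟩⟩
  choose! x hx hxs using hex
  have hmap : ∀ (y : Fin m ↪ V) (π : Equiv.Perm (Fin m)),
      Finset.univ.map (π.toEmbedding.trans y) = Finset.univ.map y := fun y π => by
    rw [← Finset.map_map, Finset.map_univ_equiv]
  have hcard : m.factorial * S.card =
      (S ×ˢ (Finset.univ : Finset (Equiv.Perm (Fin m)))).card := by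
    rw [Finset.card_product, Finset.card_univ, Fintype.card_perm, Fintype.card_fin, mul_comm]
  rw [hcard]
  refine Finset.card_le_card_of_injOn (fun q => x q.1 ∘ q.2) ?_ ?_
  · rintro ⟨s, π⟩ hq
    have hs : s ∈ S := (Finset.mem_product.1 hq).1
    refine hT (π.toEmbedding.trans ⟨x s, hx s hs⟩) ?_
    rw [hmap, hxs s hs]
    exact hs
  · rintro ⟨s, π⟩ hq ⟨s', π'⟩ hq' h
    have hs : s ∈ S := (Finset.mem_product.1 hq).1
    have hs' : s' ∈ S := (Finset.mem_product.1 hq').1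
    have h1 : π.toEmbedding.trans ⟨x s, hx s hs⟩ = π'.toEmbedding.trans ⟨x s', hx s' hs'⟩ :=
      DFunLike.coe_injective h
    obtain rfl : s = s' := by
      rw [← hxs s hs, ← hxs s' hs', ← hmap _ π, h1, hmap]
    have h2 : π = π' := Equiv.ext fun i => hx s hs (congrFun h i)
    rw [h2]

open Classical in
-- Union bound over the nontrivial characters, whose values are unit vectors of the real plane `ℂ`
-- summing to zero.
theorem card_exists_character_sum_ge_le {G : Type*} [AddCommGroup G] [Fintype G] {m : ℕ}
    (hm : 0 < m) {t : ℝ} (ht : 0 ≤ t) :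
    ((Finset.univ.filter fun a : Fin m → G =>
        ∃ χ : AddChar G ℂ, χ ≠ 0 ∧ t ≤ ‖∑ i, χ (a i)‖).card : ℝ) ≤
      (Fintype.card G - 1) * (2 * Fintype.card G ^ m * Real.exp (-(t ^ 2 / (2 * m)))) := by
  have hsub : (Finset.univ.filter fun a : Fin m → G =>
      ∃ χ : AddChar G ℂ, χ ≠ 0 ∧ t ≤ ‖∑ i, χ (a i)‖) ⊆
        (Finset.univ.erase (0 : AddChar G ℂ)).biUnion fun χ =>
          Finset.univ.filter fun a : Fin m → G => t ≤ ‖∑ i, χ (a i)‖ := fun a ha => by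
    obtain ⟨χ, hχ, h⟩ := (Finset.mem_filter.1 ha).2
    exact Finset.mem_biUnion.2 ⟨χ, by simpa using hχ, by simpa using h⟩
  refine le_trans (b := ∑ χ ∈ Finset.univ.erase (0 : AddChar G ℂ),
    ((Finset.univ.filter fun a : Fin m → G => t ≤ ‖∑ i, χ (a i)‖).card : ℝ)) ?_ ?_
  · exact_mod_cast (Finset.card_le_card hsub).trans Finset.card_biUnion_le
  · refine (Finset.sum_le_card_nsmul _ _ _ fun χ hχ =>
      card_norm_sum_ge_le (fun g => χ g) (fun g => χ.norm_apply g) ?_ hm ht).trans_eq ?_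
    · rw [AddChar.sum_eq_ite, if_neg (Finset.ne_of_mem_erase hχ)]
    · rw [Finset.card_erase_of_mem (Finset.mem_univ _), Finset.card_univ, AddChar.card_eq,
        nsmul_eq_mul, Nat.cast_pred Fintype.card_pos]

open Classical in
-- Each `m`-set has `m!` orderings. Counting all tuples with `Q`, not just injective ones, lets
-- independent draws bound the numerator.
theorem probSubset_le_of_forall_tuple {G : Type*} [Nonempty G] [Fintype G] {m : ℕ}
    (hm : m ≤ Fintype.card G)
    {P : Finset G → Prop} {Q : (Fin m → G) → Prop}
    (h : ∀ x : Fin m ↪ G, P (Finset.univ.map x) → Q x) :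
    probSubset G m P ≤
      (Finset.univ.filter Q).card / ((Fintype.card G).descFactorial m : ℝ) := by
  have h1 : m.factorial * ((Finset.univ.powersetCard m).filter P).card ≤
      (Finset.univ.filter Q).card :=
    factorial_mul_card_le
      (fun s hs => (Finset.mem_powersetCard.1 (Finset.mem_filter.1 hs).1).2)
      fun x hx => Finset.mem_filter.2 ⟨Finset.mem_univ _, h x (Finset.mem_filter.1 hx).2⟩
  have h2 : (0 : ℝ) < m.factorial := by exact_mod_cast m.factorial_pos
  have h3 : (0 : ℝ) < (Fintype.card G).choose m := by exact_mod_cast Nat.choose_pos hm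
  rw [probSubset, Finset.card_powersetCard, Finset.card_univ,
    Nat.descFactorial_eq_factorial_mul_choose,
    Nat.cast_mul, div_le_div_iff₀ h3 (mul_pos h2 h3)]
  have h4 : (m.factorial : ℝ) * ((Finset.univ.powersetCard m).filter P).card ≤
      (Finset.univ.filter Q).card := by exact_mod_cast h1
  have h5 := mul_le_mul_of_nonneg_right h4 h3.le
  linarith

end Counting
end SumComplexGap

/-! ### Assembly of the main theorem -/

theorem theorem1p2 (k : ℕ) (hk : 1 ≤ k) (ε : ℝ) (hε : 0 < ε)
    {G : Type*} [AddCommGroup G] [Fintype G] (n : ℕ) (hGn : Fintype.card G = n)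
    (hkn : k < n) (hn : (2 : ℝ) ^ 10 * (k : ℝ) ^ 8 / ε ^ 8 < (n : ℝ))
    (m : ℕ) (hm : m = ⌈4 * (k : ℝ) ^ 2 * Real.log n / ε ^ 2⌉₊) :
    m ≤ n ∧
    SumComplexGap.probSubset G m
      (fun A => SumComplexGap.spectralGap (SumComplexGap.sumComplex A k) (k - 1)
        < (1 - ε) * (m : ℝ)) < 6 / (n : ℝ) := by
  classical
  obtain ⟨j, rfl⟩ : ∃ j, k = j + 1 := ⟨k - 1, by omega⟩
  rw [Nat.add_sub_cancel]
  have hj : j < Fintype.card G := by omega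
  have hn2 : (2 : ℝ) ≤ n := by exact_mod_cast (show 2 ≤ n by omega)
  have hn0 : (0 : ℝ) < n := by linarith
  set K : ℝ := ((j + 1 : ℕ) : ℝ) with hK
  have hK1 : 1 ≤ K := by rw [hK]; exact_mod_cast hk
  have hK0 : 0 < K := by linarith
  have hlogpos : 0 < Real.log n := Real.log_pos (by linarith)
  set x := 4 * K ^ 2 * Real.log n / ε ^ 2 with hx
  have hx0 : 0 < x := by positivity
  have hxle : x ≤ 1.05 * √n := SumComplexGap.four_mul_sq_mul_log_div_le hK0 hε hn
  have hsq : √(n : ℝ) * √n = n := Real.mul_self_sqrt hn0.le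
  have hs0 : 0 ≤ √(n : ℝ) := Real.sqrt_nonneg _
  have hmpos : 0 < m := by rw [hm]; exact Nat.ceil_pos.2 hx0
  have hmpos' : (0 : ℝ) < m := by exact_mod_cast hmpos
  have hmn : m ≤ n := by
    rw [hm]
    refine Nat.ceil_le.2 (hxle.trans ?_)
    have : 1.05 ≤ √(n : ℝ) := Real.le_sqrt_of_sq_le (by norm_num; linarith)
    nlinarith
  refine ⟨hmn, ?_⟩
  -- For `ε ≥ 1` the threshold is nonpositive while the gap is nonnegative; otherwise `n ≥ 1024`
  -- becomes available.
  rcases le_or_gt 1 ε with hε1 | hε1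
  · have h0 : SumComplexGap.probSubset G m (fun A =>
        SumComplexGap.spectralGap (SumComplexGap.sumComplex A (j + 1)) j < (1 - ε) * (m : ℝ)) = 0 := by
      have h1 : ∀ A : Finset G, ¬ SumComplexGap.spectralGap (SumComplexGap.sumComplex A (j + 1)) j <
          (1 - ε) * (m : ℝ) := fun A => not_lt.2 <|
        (mul_nonpos_of_nonpos_of_nonneg (by linarith) hmpos'.le).trans
          (SumComplexGap.spectralGap_nonneg hj)
      simp [SumComplexGap.probSubset, h1]
    rw [h0]
    positivity
  have hn1024 : (1024 : ℝ) ≤ n := by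
    refine le_trans ?_ hn.le
    rw [le_div_iff₀ (by positivity)]
    have h1 : ε ^ 8 ≤ 1 := pow_le_one₀ hε.le hε1.le
    have h2 : 1 ≤ K ^ 8 := one_le_pow₀ hK1
    nlinarith
  have hdesc : (n : ℝ) ^ m / 3 ≤ n.descFactorial m := by
    refine le_trans ?_ (SumComplexGap.pow_mul_one_sub_le_descFactorial hmn)
    have h1 : (m : ℝ) < x + 1 := by rw [hm]; exact Nat.ceil_lt_add_one hx0.le
    have h32 : 32 ≤ √(n : ℝ) := Real.le_sqrt_of_sq_le (by linarith)
    have h2 : (m : ℝ) * (m - 1) / (2 * n) ≤ 2 / 3 := by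
      rw [div_le_iff₀ (by positivity)]
      have h3 : (m : ℝ) * (m - 1) ≤ (1.05 * √n + 1) * (1.05 * √n) :=
        (mul_le_mul_of_nonneg_left (show (m : ℝ) - 1 ≤ 1.05 * √n by linarith) hmpos'.le).trans
          (mul_le_mul_of_nonneg_right (by linarith) (by positivity))
      nlinarith
    rw [div_eq_mul_inv]
    exact mul_le_mul_of_nonneg_left (by linarith) (by positivity)
  set t := ε * m / K with ht
  have ht0 : 0 ≤ t := by positivity
  have hQ : ∀ a : Fin m ↪ G,
      SumComplexGap.spectralGap (SumComplexGap.sumComplex (Finset.univ.map a) (j + 1)) j <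
        (1 - ε) * (m : ℝ) → ∃ χ : AddChar G ℂ, χ ≠ 0 ∧ t ≤ ‖∑ i, χ (a i)‖ := by
    intro a ha
    by_contra! hcon
    refine absurd ha (not_lt.2 ?_)
    have h1 := SumComplexGap.card_sub_le_spectralGap (A := Finset.univ.map a) hj ht0
      fun χ hχ => by simpa using (hcon χ hχ).le
    refine le_trans (le_of_eq ?_) h1
    rw [Finset.card_map, Finset.card_univ, Fintype.card_fin, ht]
    have h2 : (j : ℝ) + 1 = K := by rw [hK]; push_cast; rfl
    rw [h2]
    field_simp
  refine (SumComplexGap.probSubset_le_of_forall_tuple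
    (Q := fun a => ∃ χ : AddChar G ℂ, χ ≠ 0 ∧ t ≤ ‖∑ i, χ (a i)‖) (hGn ▸ hmn) hQ).trans_lt ?_
  have hcard := SumComplexGap.card_exists_character_sum_ge_le (G := G) hmpos ht0
  have hexp : Real.exp (-(t ^ 2 / (2 * m))) ≤ ((n : ℝ) ^ 2)⁻¹ := by
    have h1 : x ≤ m := by rw [hm]; exact Nat.le_ceil x
    -- This is where the value of `m` comes from: the exponent must reach `2 log n` to beat the
    -- union bound.
    have h2 : 2 * Real.log n ≤ t ^ 2 / (2 * m) := by
      have h3 : t ^ 2 / (2 * m) = ε ^ 2 / (2 * K ^ 2) * m := by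
        rw [ht]; field_simp
      have h4 : 2 * Real.log n = ε ^ 2 / (2 * K ^ 2) * x := by
        rw [hx]; field_simp; ring
      rw [h3, h4]
      exact mul_le_mul_of_nonneg_left h1 (by positivity)
    rw [Real.exp_neg]
    refine inv_anti₀ (by positivity) ?_
    calc (n : ℝ) ^ 2 = Real.exp (2 * Real.log n) := by
          rw [← Real.exp_log hn0, ← Real.exp_nat_mul, Real.exp_log hn0]; norm_num
      _ ≤ _ := Real.exp_le_exp.2 h2
  rw [hGn] at hcard ⊢
  have hpow : (0 : ℝ) < n ^ m := by positivity
  have hnum : ((Finset.univ.filter fun a : Fin m → G =>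
      ∃ χ : AddChar G ℂ, χ ≠ 0 ∧ t ≤ ‖∑ i, χ (a i)‖).card : ℝ) < 2 * n ^ m / n := by
    refine hcard.trans_lt (lt_of_le_of_lt (b := (n - 1) * (2 * (n : ℝ) ^ m * ((n : ℝ) ^ 2)⁻¹)) ?_ ?_)
    · gcongr
      linarith
    · have : 2 * (n : ℝ) ^ m / n = n * (2 * (n : ℝ) ^ m * ((n : ℝ) ^ 2)⁻¹) := by
        field_simp
      rw [this]
      -- Strictness of the conclusion comes from `n - 1 < n`, the trivial character being excluded.
      exact mul_lt_mul_of_pos_right (by linarith) (by positivity)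
  rw [div_lt_iff₀ (by linarith [div_pos hpow (three_pos (α := ℝ))])]
  refine lt_of_eq_of_lt (by congr) (hnum.trans_le ?_)
  calc 2 * (n : ℝ) ^ m / n = 6 / n * ((n : ℝ) ^ m / 3) := by ring
    _ ≤ _ := mul_le_mul_of_nonneg_left hdesc (by positivity)
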